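/- Let $p$ be a prime, $N \ge 1$, $s = p^N$, $d = s^2$ and $m \ge 2$. On $\mathbb{C}^p$ with computational basis $|k\rangle$, $k \in \mathbb{Z}/p$, let $X|k\rangle = |k+1\rangle$ and $Z|k\rangle = \omega^k |k\rangle$ with $\omega = e^{2\pi i/p}$, and call the operators $X^{a_1}Z^{b_1} \otimes \cdots \otimes X^{a_N}Z^{b_N}$ on $\mathbb{C}^s = (\mathbb{C}^p)^{\otimes N}$ with $a_j, b_j \in \{0,\dots,p-1\}$ strings of Pauli matrices. Let $C_1,\dots,C_m$ be pairwise disjoint sets, each consisting of $s-1$ pairwise commuting strings of Pauli matrices different from the identity (for instance $m$ of the classes in a partition of all $s^2-1$ non-identity strings into $s+1$ such sets). For each $t$ let $\mathcal{S}_t = \{U_t|k\rangle\}_k$, with $U_t$ unitary, be an orthonormal basis of $\mathbb{C}^s$ consisting of common eigenvectors of all elements of $C_t$. Let $\mathcal{B}_t$ be the basis $\{(U_t \otimes U_t^*)|k,l\rangle\}_{k,l}$ of $\mathbb{C}^s \otimes \mathbb{C}^s \cong \mathbb{C}^d$, where $U_t^*$ is the entrywise complex conjugate of $U_t$, and denote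 its elements by $|b^t_1\rangle,\dots,|b^t_d\rangle$. Then $\mathcal{S}_1,\dots,\mathcal{S}_m$ are mutually unbiased bases of $\mathbb{C}^s$, $\mathcal{B}_1,\dots,\mathcal{B}_m$ are mutually unbiased bases of $\mathbb{C}^d$, and the accessible information of the ensemble $\mathcal{E} = \{\frac{1}{dm}, |b^t_k\rangle\langle b^t_k|\}_{t \in \{1,\dots,m\},\, k \in \{1,\dots,d\}}$ is $$\mathcal{I}_{acc}(\mathcal{E}) = \frac{\log_2 d}{2}.$$ Here $\mathcal{I}_{acc}(\mathcal{E})$ is the maximum, over all POVMs with finitely many outcomes, of the classical mutual information $H(P_A) + H(P_B) - H(P_{AB})$ (in bits) between the label $(t,k)$ and the measurement outcome; this maximum is attained, and it is the same if only POVMs with elements $\alpha_i|\Phi_i\rangle\langle\Phi_i|$, $\alpha_i \ge 0$, $\|\Phi_i\| = 1$, are allowed. In particular the value does not depend on $m$: using more than two such bases locks no better than using two. -/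

import Mathlib

open scoped Kronecker ComplexOrder

noncomputable section

namespace PauliLocking

/-! Generalized Pauli matrices and strings of them. The computational basis of `ℂ^p` is indexed by
`ZMod p`, the one of `(ℂ^p)^{⊗ N} = ℂ^(p ^ N)` by `Fin N → ZMod p`. -/

/-- The shift `X |k⟩ = |k + 1⟩` (addition modulo `p`). -/
def pauliX (p : ℕ) : Matrix (ZMod p) (ZMod p) ℂ :=
  Matrix.of fun i k => if i = k + 1 then 1 else 0

/-- The phase `Z |k⟩ = ω ^ k |k⟩`, with `ω = exp (2 π i / p)`. -/
def pauliZ (p : ℕ) : Matrix (ZMod p) (ZMod p) ℂ :=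
  Matrix.diagonal fun k => Complex.exp (2 * Real.pi * Complex.I / p) ^ k.val

/-- The exponents `(a, b)` of a string of Pauli matrices. -/
abbrev PauliLabel (p N : ℕ) : Type := (Fin N → ZMod p) × (Fin N → ZMod p)

/-- The string `X ^ a₁ Z ^ b₁ ⊗ ⋯ ⊗ X ^ a_N Z ^ b_N`, with `a_j, b_j ∈ {0, …, p - 1}`; an entry of a
tensor product is the product of the entries of the factors. For prime `p`, different labels give
different strings. -/
def pauliString {p N : ℕ} [NeZero p] (g : PauliLabel p N) :
    Matrix (Fin N → ZMod p) (Fin N → ZMod p) ℂ :=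
  Matrix.of fun i k => ∏ j, (pauliX p ^ (g.1 j).val * pauliZ p ^ (g.2 j).val) (i j) (k j)

/-- A class of `p ^ N - 1` commuting strings of Pauli matrices, the identity excluded. -/
structure IsPauliClass {p N : ℕ} [NeZero p] (C : Finset (PauliLabel p N)) : Prop where
  card_eq : C.card = p ^ N - 1
  ne_one : ∀ g ∈ C, pauliString g ≠ 1
  comm : ∀ g ∈ C, ∀ h ∈ C, Commute (pauliString g) (pauliString h)

/-- The unitaries `U t` carry the computational basis to orthonormal bases (their columns) which are
constructed from generalized Pauli matrices: the `t`-th one is a common eigenbasis of the `t`-th of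
`m` pairwise disjoint classes of commuting strings. -/
def IsPauliFamily {p N m : ℕ} [NeZero p]
    (U : Fin m → Matrix (Fin N → ZMod p) (Fin N → ZMod p) ℂ) : Prop :=
  (∀ t, U t ∈ Matrix.unitaryGroup (Fin N → ZMod p) ℂ) ∧
    ∃ C : Fin m → Finset (PauliLabel p N),
      (∀ t, IsPauliClass (C t)) ∧
      (∀ t t', t ≠ t' → Disjoint (C t) (C t')) ∧
      ∀ t, ∀ g ∈ C t, ∀ k, ∃ c : ℂ, (pauliString g).mulVec ((U t).col k) = c • (U t).col k

/-- The columns of the matrices `V t` are mutually unbiased orthonormal bases. -/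
def IsMUBFamily {ι : Type*} [Fintype ι] [DecidableEq ι] {m : ℕ}
    (V : Fin m → Matrix ι ι ℂ) : Prop :=
  (∀ t, V t ∈ Matrix.unitaryGroup ι ℂ) ∧
    ∀ t t', t ≠ t' → ∀ k l,
      ‖star ((V t).col k) ⬝ᵥ (V t').col l‖ = 1 / Real.sqrt (Fintype.card ι)

/-- `U ⊗ U^*`, where `U^*` is the entrywise complex conjugate of `U`. -/
def productUnitary {ι : Type*} (U : Matrix ι ι ℂ) : Matrix (ι × ι) (ι × ι) ℂ :=
  U ⊗ₖ U.map (starRingEnd ℂ)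

/-- The projector `|v⟩⟨v|`. -/
def ketbra {ι : Type*} (v : ι → ℂ) : Matrix ι ι ℂ := Matrix.vecMulVec v (star v)

/-- A measurement (POVM) with outcomes in `Fin n`. -/
def IsPOVM {ι : Type*} [Fintype ι] [DecidableEq ι] {n : ℕ} (M : Fin n → Matrix ι ι ℂ) : Prop :=
  (∀ i, (M i).PosSemidef) ∧ ∑ i, M i = 1

/-- All elements have the form `α |Φ⟩⟨Φ|` with `α ≥ 0` and `Φ` a unit vector. -/
def IsRankOne {ι : Type*} [Fintype ι] {n : ℕ} (M : Fin n → Matrix ι ι ℂ) : Prop :=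
  ∀ i, ∃ (α : ℝ) (Φ : ι → ℂ), 0 ≤ α ∧ star Φ ⬝ᵥ Φ = 1 ∧ M i = (α : ℂ) • ketbra Φ

/-- Shannon entropy in bits. -/
def shannonEntropy {κ : Type*} [Fintype κ] (q : κ → ℝ) : ℝ :=
  -∑ x, q x * Real.logb 2 (q x)

/-- Classical mutual information `H(P_A) + H(P_B) - H(P_AB)` of a joint distribution. -/
def mutualInformation {κ κ' : Type*} [Fintype κ] [Fintype κ'] (P : κ → κ' → ℝ) : ℝ :=
  shannonEntropy (fun x => ∑ y, P x y) + shannonEntropy (fun y => ∑ x, P x y)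
    - shannonEntropy (fun z : κ × κ' => P z.1 z.2)

/-- The joint distribution of the label `x` of the ensemble `{q x, ρ x}` and the outcome `i` of the
measurement `M`: `q x * Tr (M i ρ x)`. -/
def jointDistribution {ι κ : Type*} [Fintype ι] {n : ℕ}
    (q : κ → ℝ) (ρ : κ → Matrix ι ι ℂ) (M : Fin n → Matrix ι ι ℂ) (x : κ) (i : Fin n) : ℝ :=
  q x * (Matrix.trace (M i * ρ x)).re

/-- The accessible information of the ensemble `{q x, ρ x}` is `v`: the maximum over all
measurements of the mutual information between label and outcome is attained, and it is `v`. -/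
def IsAccessibleInformation {ι κ : Type*} [Fintype ι] [DecidableEq ι] [Fintype κ]
    (q : κ → ℝ) (ρ : κ → Matrix ι ι ℂ) (v : ℝ) : Prop :=
  IsGreatest {r : ℝ | ∃ (n : ℕ) (M : Fin n → Matrix ι ι ℂ), IsPOVM M ∧
    r = mutualInformation (jointDistribution q ρ M)} v

/-- The same maximum over the measurements with rank one elements `α_i |Φ_i⟩⟨Φ_i|` only. For such a
measurement the mutual information is
`- ∑ x, q x log (q x) + ∑ i, ∑ x, q x α_i ⟨Φ_i|ρ x|Φ_i⟩ log (q x ⟨Φ_i|ρ x|Φ_i⟩ / ⟨Φ_i|μ|Φ_i⟩)`, where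
`μ = ∑ x, q x ρ x`. -/
def IsRankOneAccessibleInformation {ι κ : Type*} [Fintype ι] [DecidableEq ι] [Fintype κ]
    (q : κ → ℝ) (ρ : κ → Matrix ι ι ℂ) (v : ℝ) : Prop :=
  IsGreatest {r : ℝ | ∃ (n : ℕ) (M : Fin n → Matrix ι ι ℂ), IsPOVM M ∧ IsRankOne M ∧
    r = mutualInformation (jointDistribution q ρ M)} v

/-- The prior `1 / (d m)` on the labels `(t, k)` of `m` bases of a `d`-dimensional space. -/
def uniformPrior (m : ℕ) (ι : Type*) [Fintype ι] (_x : Fin m × ι) : ℝ :=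
  1 / ((Fintype.card ι : ℝ) * m)

/-- The state `|b^t_k⟩⟨b^t_k|`, where `b^t_k` is the `k`-th column of `V t`. -/
def basisState {m : ℕ} {ι : Type*} (V : Fin m → Matrix ι ι ℂ) (x : Fin m × ι) : Matrix ι ι ℂ :=
  ketbra ((V x.1).col x.2)

end PauliLocking

end

namespace PauliLocking

-- Upper bound: the Maassen–Uffink relation holds for each POVM element and each pair of bases.
-- Averaged over all pairs, it bounds the information by half of `log d` for any `m ≥ 2` mutually
-- unbiased bases and any POVM (`mutualInformation_le_of_isMUBFamily`). The uncertainty relation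
-- comes from Hadamard's three lines theorem, as an inequality between derivatives at an endpoint of
-- the strip.
--
-- Attainment: one measurement serves all the bases, namely the Bell basis of vectorized strings.
-- Its overlap with `(U ⊗ U^*)|j,k⟩` is, up to conjugation and the factor `1 / √s`, the entry
-- `(j,k)` of `U⋆ P U` for a string `P`. As `P` commutes with each element of a class up to a phase,
-- it permutes the common eigenvectors up to phases, so each squared overlap is `0` or `1 / s`. All
-- distributions are then uniform on their supports, and the information is `log s = (log d) / 2`
-- (`IsPauliFamily.mutualInformation_bellBasis`).
--
-- Unbiasedness: a class with the identity has `s` orthogonal elements, hence spans the matrices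
-- diagonal in its eigenbasis. Disjoint classes thus share only the identity direction.

-- The entropic uncertainty relation

/-- An exponential sum bounded by `1` on `re z = 0` and by `c` on `re z = 1`, with value `1` at `0`,
has derivative at most `log c` at `0`. -/
lemma re_sum_mul_le_log_of_three_lines {J : Type*} [Fintype J] (G : J → ℂ) (γ : J → ℝ) {c : ℝ}
    (hc : 0 < c) (h_zero : ∑ j, G j = 1)
    (h_left : ∀ z : ℂ, z.re = 0 → ‖∑ j, G j * Complex.exp (z * γ j)‖ ≤ 1)
    (h_right : ∀ z : ℂ, z.re = 1 → ‖∑ j, G j * Complex.exp (z * γ j)‖ ≤ c) :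
    (∑ j, G j * γ j).re ≤ Real.log c := by
  set f : ℂ → ℂ := fun z => ∑ j, G j * Complex.exp (z * γ j) with hf
  have hdiff : Differentiable ℂ f := by
    rw [hf]; fun_prop
  have hbound : BddAbove ((norm ∘ f) '' Complex.HadamardThreeLines.verticalClosedStrip 0 1) := by
    refine ⟨∑ j, ‖G j‖ * Real.exp |γ j|, ?_⟩
    rintro _ ⟨z, hz, rfl⟩
    refine (norm_sum_le _ _).trans (Finset.sum_le_sum fun j _ => ?_)
    rw [norm_mul, Complex.norm_exp]
    have hz' : 0 ≤ z.re ∧ z.re ≤ 1 := hz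
    gcongr
    rw [Complex.re_mul_ofReal]
    calc z.re * γ j ≤ z.re * |γ j| := by gcongr; exacts [hz'.1, le_abs_self _]
      _ ≤ 1 * |γ j| := by gcongr; exact hz'.2
      _ = |γ j| := one_mul _
  have hinterp : ∀ x ∈ Set.Icc (0 : ℝ) 1, (f x).re ≤ c ^ x := by
    intro x hx
    have := Complex.HadamardThreeLines.norm_le_interp_of_mem_verticalClosedStrip₀₁' f
      (z := x) (a := 1) (b := c) (by simpa [Complex.HadamardThreeLines.verticalClosedStrip] using hx)
      hdiff.diffContOnCl hbound (fun z hz => h_left z hz) (fun z hz => h_right z hz)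
    simp only [Real.one_rpow, one_mul, Complex.ofReal_re] at this
    exact (Complex.re_le_norm _).trans this
  have hderiv : HasDerivAt f (∑ j, G j * γ j) ((0 : ℝ) : ℂ) := by
    have : ∀ j ∈ Finset.univ, HasDerivAt (fun z : ℂ => G j * Complex.exp (z * γ j))
        (G j * γ j) ((0 : ℝ) : ℂ) := by
      intro j _
      have h := (((hasDerivAt_id ((0 : ℝ) : ℂ)).mul_const (γ j : ℂ)).cexp).const_mul (G j)
      simpa using h
    exact HasDerivAt.fun_sum this
  have hre : HasDerivAt (fun x : ℝ => (f x).re) (∑ j, G j * γ j).re 0 := hderiv.real_of_complex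
  have hpow : HasDerivAt (fun x : ℝ => c ^ x) (Real.log c) 0 := by
    simpa using (Real.hasStrictDerivAt_const_rpow hc (0 : ℝ)).hasDerivAt
  have hsub := (hpow.sub hre).hasDerivWithinAt (s := Set.Ici 0)
  -- The difference is nonnegative on `[0, 1]` and vanishes at `0`, so its right derivative there,
  -- `log c` minus the derivative of `re f`, is nonnegative.
  have hmin : IsLocalMinOn ((fun x : ℝ => c ^ x) - fun x : ℝ => (f x).re) (Set.Ici 0) 0 := by
    have : Set.Icc (0 : ℝ) 1 ∈ nhdsWithin 0 (Set.Ici 0) := Icc_mem_nhdsGE one_pos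
    filter_upwards [this] with x hx
    have h0 : f 0 = 1 := by simpa [hf] using h_zero
    simpa [h0] using hinterp x hx
  have := hmin.hasFDerivWithinAt_nonneg hsub.hasFDerivWithinAt (y := 1)
    (mem_posTangentConeAt_of_segment_subset
      ((convex_Ici (0 : ℝ)).segment_subset (by simp) (by simp)))
  simpa using this

/-- With a phase `u` making `u * tr (X ρ)` equal to its norm, the trace of the positive semidefinite
matrix `(1 - u X) ρ (1 - u X)⋆` is `2 tr ρ - 2 |tr (X ρ)|`. -/
lemma norm_trace_unitary_mul_le {ι : Type*} [Fintype ι] [DecidableEq ι] {X ρ : Matrix ι ι ℂ}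
    (hX : X ∈ Matrix.unitaryGroup ι ℂ) (hρ : ρ.PosSemidef) :
    ‖(X * ρ).trace‖ ≤ ρ.trace.re := by
  obtain ⟨u, hu, hut⟩ : ∃ u : ℂ, ‖u‖ = 1 ∧ ((‖(X * ρ).trace‖ : ℝ) : ℂ) = u * (X * ρ).trace := by
    obtain ⟨u, hu, h⟩ := RCLike.exists_norm_eq_mul_self (K := ℂ) (X * ρ).trace
    exact ⟨u, hu, h⟩
  have huu : star u * u = 1 := by
    have := Complex.conj_mul' u
    rw [hu] at this
    simpa using this
  have hXX : X.conjTranspose * X = 1 := Matrix.mem_unitaryGroup_iff'.mp hX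
  have h1 := (hρ.mul_mul_conjTranspose_same (1 - u • X)).trace_nonneg
  have h2 : ((1 - u • X) * ρ * (1 - u • X).conjTranspose).trace
      = 2 * ρ.trace - u * (X * ρ).trace - star (u * (X * ρ).trace) := by
    have e1 : (ρ * X.conjTranspose).trace = star (X * ρ).trace := by
      rw [← Matrix.trace_conjTranspose, Matrix.conjTranspose_mul, hρ.isHermitian.eq]
    have e2 : (X * ρ * X.conjTranspose).trace = ρ.trace := by
      rw [Matrix.trace_mul_comm, ← Matrix.mul_assoc, hXX, Matrix.one_mul]
    simp only [Matrix.conjTranspose_sub, Matrix.conjTranspose_one, Matrix.conjTranspose_smul,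
      Matrix.sub_mul, Matrix.mul_sub, Matrix.one_mul, Matrix.mul_one, Matrix.smul_mul,
      Matrix.mul_smul, Matrix.trace_sub, Matrix.trace_smul, e1, e2, smul_eq_mul, star_mul']
    linear_combination ρ.trace * huu
  rw [h2, ← hut] at h1
  have := (Complex.le_def.mp h1).1
  simp at this
  linarith

lemma re_conjTranspose_mul_self_apply {r ι : Type*} [Fintype r] (A : Matrix r ι ℂ) (i : ι) :
    ((A.conjTranspose * A) i i).re = ∑ y, ‖A y i‖ ^ 2 := by
  rw [Matrix.mul_apply, Complex.re_sum]
  refine Finset.sum_congr rfl fun y _ => ?_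
  have := Complex.conj_mul' (A y i)
  simp only [Matrix.conjTranspose_apply, RCLike.star_def, this]
  norm_cast

lemma norm_conjTranspose_mul_apply_le {r ι κ : Type*} [Fintype r] (A : Matrix r ι ℂ)
    (B : Matrix r κ ℂ) (i : ι) (k : κ) :
    ‖(A.conjTranspose * B) i k‖
      ≤ √((A.conjTranspose * A) i i).re * √((B.conjTranspose * B) k k).re := by
  rw [re_conjTranspose_mul_self_apply, re_conjTranspose_mul_self_apply, Matrix.mul_apply]
  refine (norm_sum_le _ _).trans ?_
  simp only [norm_mul, Matrix.conjTranspose_apply, norm_star]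
  exact Real.sum_mul_le_sqrt_mul_sqrt _ _ _

/-- Zero probabilities need no separate treatment: at `x = 0` the factor `√x` vanishes, whatever
value `Real.log 0` has. -/
lemma exp_half_log_mul_sqrt {x : ℝ} (hx : 0 ≤ x) : Real.exp (Real.log x / 2) * √x = x := by
  rcases hx.eq_or_lt with rfl | hx
  · simp
  · rw [← Real.log_sqrt hx.le, Real.exp_log (Real.sqrt_pos.mpr hx), Real.mul_self_sqrt hx.le]

lemma diagonal_exp_mem_unitaryGroup {ι : Type*} [Fintype ι] [DecidableEq ι] (z : ℂ) (hz : z.re = 0)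
    (α : ι → ℝ) : Matrix.diagonal (fun k => Complex.exp (z * α k)) ∈ Matrix.unitaryGroup ι ℂ := by
  rw [Matrix.mem_unitaryGroup_iff', Matrix.star_eq_conjTranspose, Matrix.diagonal_conjTranspose,
    Matrix.diagonal_mul_diagonal, ← Matrix.diagonal_one]
  congr 1
  funext k
  have h := Complex.conj_mul' (Complex.exp (z * α k))
  rw [Complex.norm_exp, Complex.re_mul_ofReal, hz] at h
  simpa using h

/-- The entropic uncertainty relation of Maassen and Uffink, for the diagonals of a density matrix
in two bases related by the unitary `W`. -/
theorem sum_mul_log_add_sum_mul_log_le {ι : Type*} [Fintype ι] [DecidableEq ι] {W ρ : Matrix ι ι ℂ}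
    (hW : W ∈ Matrix.unitaryGroup ι ℂ) {c : ℝ} (hc : 0 < c) (hWc : ∀ l k, ‖W l k‖ ≤ c)
    (hρ : ρ.PosSemidef) (htr : ρ.trace = 1) :
    ∑ k, (ρ k k).re * Real.log (ρ k k).re
      + ∑ l, ((W * ρ * W.conjTranspose) l l).re * Real.log ((W * ρ * W.conjTranspose) l l).re
      ≤ 2 * Real.log c := by
  set σ := W * ρ * W.conjTranspose with hσ
  have hWW : W.conjTranspose * W = 1 := Matrix.mem_unitaryGroup_iff'.mp hW
  have hσp : σ.PosSemidef := hρ.mul_mul_conjTranspose_same W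
  have hσtr : σ.trace = 1 := by
    rw [hσ, Matrix.trace_mul_comm, ← Matrix.mul_assoc, hWW, Matrix.one_mul, htr]
  have hp : ∀ k, 0 ≤ (ρ k k).re := fun k => (Complex.le_def.mp (hρ.diag_nonneg (i := k))).1
  have hq : ∀ l, 0 ≤ (σ l l).re := fun l => (Complex.le_def.mp (hσp.diag_nonneg (i := l))).1
  have hp1 : ∑ k, (ρ k k).re = 1 := by
    simpa [Matrix.trace] using congrArg Complex.re htr
  have hq1 : ∑ k, (σ k k).re = 1 := by
    simpa [Matrix.trace] using congrArg Complex.re hσtr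
  -- The halves make `exp α` and `exp β` at `re z = 1` complete the square roots of the
  -- Cauchy–Schwarz bound to the probabilities themselves.
  set α : ι → ℝ := fun k => Real.log (ρ k k).re / 2 with hα
  set β : ι → ℝ := fun l => Real.log (σ l l).re / 2 with hβ
  -- The exponential sum is `tr (exp(zα) W⋆ exp(zβ) W ρ)`, with `α`, `β` as diagonal matrices. The
  -- marginals of `G` are the two diagonals, so the derivative at `0` is half of the left-hand side.
  set G : ι × ι → ℂ := fun x => W.conjTranspose x.1 x.2 * (W * ρ) x.2 x.1 with hG
  have hGk : ∀ k, ∑ l, G (k, l) = ρ k k := by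
    intro k
    change ∑ l, W.conjTranspose k l * (W * ρ) l k = ρ k k
    rw [← Matrix.mul_apply, ← Matrix.mul_assoc, hWW, Matrix.one_mul]
  have hGl : ∀ l, ∑ k, G (k, l) = σ l l := by
    intro l
    rw [hσ, Matrix.mul_apply]
    exact Finset.sum_congr rfl fun k _ => mul_comm _ _
  have key := re_sum_mul_le_log_of_three_lines G (fun x => α x.1 + β x.2) hc ?_ ?_ ?_
  · have e : ∑ x, G x * ((α x.1 + β x.2 : ℝ) : ℂ)
        = ∑ k, ρ k k * (α k : ℂ) + ∑ l, σ l l * (β l : ℂ) := by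
      simp only [Complex.ofReal_add, mul_add, Finset.sum_add_distrib]
      rw [Fintype.sum_prod_type, Fintype.sum_prod_type_right]
      simp only [← Finset.sum_mul, hGk, hGl]
    rw [e] at key
    simp only [Complex.add_re, Complex.re_sum, Complex.re_mul_ofReal, hα, hβ, mul_div_assoc',
      ← Finset.sum_div] at key
    linarith
  · rw [Fintype.sum_prod_type]
    simp only [hGk]
    exact htr
  -- On the imaginary axis the diagonal factors are unitary, and the sum is the trace of a unitary
  -- times `ρ`.
  · intro z hz
    have hX := mul_mem (mul_mem (mul_mem (diagonal_exp_mem_unitaryGroup z hz α)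
      (Unitary.star_mem hW)) (diagonal_exp_mem_unitaryGroup z hz β)) hW
    have h := norm_trace_unitary_mul_le hX hρ
    rw [htr, Complex.one_re] at h
    convert h using 2
    rw [Matrix.mul_assoc _ W ρ, Matrix.mul_assoc _ (Matrix.diagonal _) (W * ρ),
      Matrix.mul_assoc (Matrix.diagonal _), Matrix.trace, Fintype.sum_prod_type]
    refine Finset.sum_congr rfl fun k _ => ?_
    rw [Matrix.diag_apply, Matrix.diagonal_mul, Matrix.mul_apply, Finset.mul_sum]
    refine Finset.sum_congr rfl fun l _ => ?_
    rw [Matrix.diagonal_mul, hG, Complex.ofReal_add, mul_add, Complex.exp_add]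
    simp only [Matrix.star_eq_conjTranspose]
    ring
  · intro z hz
    obtain ⟨L, hL⟩ : ∃ L : Matrix ι ι ℂ, ρ = L.conjTranspose * L := by
      open scoped MatrixOrder in
      obtain ⟨L, hL⟩ := CStarAlgebra.nonneg_iff_eq_star_mul_self.mp hρ.nonneg
      exact ⟨L, hL⟩
    -- With `ρ = L⋆ L`, this is Cauchy–Schwarz for a column of `L W⋆` and a column of `L`.
    have hcs : ∀ k l, ‖(W * ρ) l k‖ ≤ √(σ l l).re * √(ρ k k).re := by
      intro k l
      have h := norm_conjTranspose_mul_apply_le (L * W.conjTranspose) L l k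
      rw [← hL, Matrix.conjTranspose_mul, Matrix.conjTranspose_conjTranspose, Matrix.mul_assoc,
        ← hL, Matrix.mul_assoc, ← Matrix.mul_assoc _ L, ← hL, ← Matrix.mul_assoc] at h
      exact h
    calc ‖∑ x, G x * Complex.exp (z * ((α x.1 + β x.2 : ℝ) : ℂ))‖
        ≤ ∑ x : ι × ι, c * ((ρ x.1 x.1).re * (σ x.2 x.2).re) := by
          refine (norm_sum_le _ _).trans (Finset.sum_le_sum fun x _ => ?_)
          rw [norm_mul, Complex.norm_exp, Complex.re_mul_ofReal, hz, one_mul, Real.exp_add, hG,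
            norm_mul, Matrix.conjTranspose_apply, norm_star]
          calc ‖W x.2 x.1‖ * ‖(W * ρ) x.2 x.1‖ * (Real.exp (α x.1) * Real.exp (β x.2))
              ≤ c * (√(σ x.2 x.2).re * √(ρ x.1 x.1).re)
                  * (Real.exp (α x.1) * Real.exp (β x.2)) := by
                gcongr
                exacts [hWc _ _, hcs _ _]
            _ = c * ((Real.exp (α x.1) * √(ρ x.1 x.1).re)
                  * (Real.exp (β x.2) * √(σ x.2 x.2).re)) := by ring
            _ = _ := by rw [hα, hβ, exp_half_log_mul_sqrt (hp _), exp_half_log_mul_sqrt (hq _)]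
      _ = c := by
          rw [← Finset.mul_sum, Fintype.sum_prod_type]
          simp only [← Finset.mul_sum, hq1, mul_one, hp1]

/-- The homogeneous form of the uncertainty relation, for a positive semidefinite matrix and two
bases given by the columns of `V` and `V'`. -/
theorem sum_mul_log_add_sum_mul_log_le_trace {ι : Type*} [Fintype ι] [DecidableEq ι]
    {V V' M : Matrix ι ι ℂ} (hV : V ∈ Matrix.unitaryGroup ι ℂ) (hV' : V' ∈ Matrix.unitaryGroup ι ℂ)
    {c : ℝ} (hc : 0 < c) (hVV' : ∀ l k, ‖(V'.conjTranspose * V) l k‖ ≤ c) (hM : M.PosSemidef) :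
    ∑ k, ((V.conjTranspose * M * V) k k).re * Real.log ((V.conjTranspose * M * V) k k).re
      + ∑ l, ((V'.conjTranspose * M * V') l l).re * Real.log ((V'.conjTranspose * M * V') l l).re
      ≤ 2 * M.trace.re * Real.log M.trace.re + 2 * M.trace.re * Real.log c := by
  have hT : 0 ≤ M.trace := hM.trace_nonneg
  have hTre : ((M.trace.re : ℝ) : ℂ) = M.trace := (Complex.eq_re_of_ofReal_le hT).symm
  set T := M.trace.re with hTdef
  rcases eq_or_ne T 0 with h0 | h0
  · have : M = 0 := hM.trace_eq_zero_iff.mp (by rw [← hTre, h0, Complex.ofReal_zero])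
    simp [this, h0]
  have hTpos : 0 < T := lt_of_le_of_ne (Complex.le_def.mp hT).1 (Ne.symm h0)
  have hVV : V * V.conjTranspose = 1 := Matrix.mem_unitaryGroup_iff.mp hV
  have hV'V' : V' * V'.conjTranspose = 1 := Matrix.mem_unitaryGroup_iff.mp hV'
  -- The normalized `M` written in the basis `V`; conjugation by `V'⋆ V` rewrites it in the basis
  -- `V'`.
  set ρ : Matrix ι ι ℂ := ((T⁻¹ : ℝ) : ℂ) • (V.conjTranspose * M * V) with hρdef
  have hρ : ρ.PosSemidef := (hM.conjTranspose_mul_mul_same V).smul (by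
    rw [Complex.zero_le_real]; positivity)
  have htr : ρ.trace = 1 := by
    rw [hρdef, Matrix.trace_smul, Matrix.trace_mul_comm, ← Matrix.mul_assoc, hVV, Matrix.one_mul,
      ← hTre, smul_eq_mul, ← Complex.ofReal_mul, inv_mul_cancel₀ h0, Complex.ofReal_one]
  have hW : V'.conjTranspose * V ∈ Matrix.unitaryGroup ι ℂ := mul_mem (Unitary.star_mem hV') hV
  have hσ : V'.conjTranspose * V * ρ * (V'.conjTranspose * V).conjTranspose
      = ((T⁻¹ : ℝ) : ℂ) • (V'.conjTranspose * M * V') := by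
    have : V'.conjTranspose * V * (V.conjTranspose * M * V) * (V.conjTranspose * V')
        = V'.conjTranspose * (V * V.conjTranspose) * M * (V * V.conjTranspose) * V' := by
      simp only [Matrix.mul_assoc]
    rw [hρdef, Matrix.conjTranspose_mul, Matrix.conjTranspose_conjTranspose, Matrix.mul_smul,
      Matrix.smul_mul, this, hVV, Matrix.mul_one, Matrix.mul_one]
  have key := sum_mul_log_add_sum_mul_log_le hW hc hVV' hρ htr
  rw [hσ] at key
  have hscale : ∀ (A : Matrix ι ι ℂ), A.trace = M.trace →
      ∑ k, ((((T⁻¹ : ℝ) : ℂ) • A) k k).re * Real.log ((((T⁻¹ : ℝ) : ℂ) • A) k k).re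
        = T⁻¹ * ∑ k, (A k k).re * Real.log (A k k).re - Real.log T := by
    intro A hA
    have hsum : ∑ k, (A k k).re = T := by
      rw [hTdef, ← hA, Matrix.trace, Complex.re_sum]; rfl
    have : ∀ k, ((((T⁻¹ : ℝ) : ℂ) • A) k k).re * Real.log ((((T⁻¹ : ℝ) : ℂ) • A) k k).re
        = T⁻¹ * ((A k k).re * Real.log (A k k).re) - T⁻¹ * Real.log T * (A k k).re := by
      intro k
      rw [Matrix.smul_apply, smul_eq_mul, Complex.re_ofReal_mul]
      rcases eq_or_ne (A k k).re 0 with hz | hz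
      · simp [hz]
      · rw [Real.log_mul (inv_ne_zero h0) hz, Real.log_inv]; ring
    simp only [this, Finset.sum_sub_distrib, ← Finset.mul_sum, hsum]
    field_simp
  rw [hρdef, hscale _ (by rw [Matrix.trace_mul_comm, ← Matrix.mul_assoc, hVV, Matrix.one_mul]),
    hscale _ (by rw [Matrix.trace_mul_comm, ← Matrix.mul_assoc, hV'V', Matrix.one_mul])] at key
  have := mul_le_mul_of_nonneg_left key hTpos.le
  simp only [mul_add, mul_sub, ← mul_assoc, mul_inv_cancel₀ h0, one_mul] at this
  linarith

-- Mutual information of an ensemble of bases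

lemma shannonEntropy_eq_sum_negMulLog {κ : Type*} [Fintype κ] (q : κ → ℝ) :
    shannonEntropy q = (∑ x, Real.negMulLog (q x)) / Real.log 2 := by
  simp only [shannonEntropy, Real.negMulLog_eq_neg, Real.logb, Finset.sum_neg_distrib, neg_div,
    Finset.sum_div, mul_div_assoc]

/-- A distribution which is uniform on its support, with weight `c`, has entropy `- log c`. -/
lemma shannonEntropy_of_eq_zero_or_eq {κ : Type*} [Fintype κ] {q : κ → ℝ} {c : ℝ}
    (hq : ∀ x, q x = 0 ∨ q x = c) (hsum : ∑ x, q x = 1) : shannonEntropy q = -Real.logb 2 c := by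
  have : ∀ x, q x * Real.logb 2 (q x) = q x * Real.logb 2 c := by
    intro x
    rcases hq x with h | h <;> simp [h]
  rw [shannonEntropy]
  simp only [this, ← Finset.sum_mul, hsum, one_mul]

/-- Sum the hypothesis over all ordered pairs, keeping `2 * S t` on the diagonal; the result is `(m
- 1) ∑ S ≤ m (m - 1) K`, and `m - 1 > 0`. -/
lemma sum_le_of_forall_pair {m : ℕ} (hm : 2 ≤ m) (S : Fin m → ℝ) {K : ℝ}
    (h : ∀ t t', t ≠ t' → S t + S t' ≤ 2 * K) : ∑ t, S t ≤ m * K := by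
  have hle : ∑ t, ∑ t', (S t + S t') ≤ ∑ t, ∑ t', (2 * K + if t = t' then 2 * S t - 2 * K else 0) := by
    refine Finset.sum_le_sum fun t _ => Finset.sum_le_sum fun t' _ => ?_
    split_ifs with htt
    · subst htt; linarith
    · simpa using h t t' htt
  simp only [Finset.sum_add_distrib, Finset.sum_const, Finset.card_univ, Fintype.card_fin,
    nsmul_eq_mul, Finset.sum_ite_eq, Finset.mem_univ, if_true, Finset.sum_sub_distrib,
    ← Finset.mul_sum] at hle
  have hm1 : (0 : ℝ) < (m : ℝ) - 1 := by
    have : (2 : ℝ) ≤ m := by exact_mod_cast hm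
    linarith
  nlinarith

/-- If the outcome distributions satisfy an uncertainty relation for each pair of bases, then the
mutual information between the label and the outcome is at most half of the maximal one. -/
lemma mutualInformation_le_of_uncertainty {κ : Type*} [Fintype κ] [Nonempty κ] {m n : ℕ}
    (hm : 2 ≤ m) (w : Fin m → κ → Fin n → ℝ) (T : Fin n → ℝ)
    (hlabel : ∀ t k, ∑ i, w t k i = 1) (houtcome : ∀ t i, ∑ k, w t k i = T i)
    (hT : ∑ i, T i = Fintype.card κ)
    (hunc : ∀ t t', t ≠ t' → ∀ i,
      ∑ k, w t k i * Real.log (w t k i) + ∑ k, w t' k i * Real.log (w t' k i)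
        ≤ 2 * T i * Real.log (T i) - T i * Real.log (Fintype.card κ)) :
    mutualInformation (fun (x : Fin m × κ) i => 1 / ((Fintype.card κ : ℝ) * m) * w x.1 x.2 i)
      ≤ Real.logb 2 (Fintype.card κ) / 2 := by
  set d := (Fintype.card κ : ℝ) with hd
  have hd0 : 0 < d := by rw [hd]; exact_mod_cast Fintype.card_pos
  have hm0 : (0 : ℝ) < m := by exact_mod_cast (by omega : 0 < m)
  have hlabels : shannonEntropy (fun x : Fin m × κ => ∑ i, 1 / (d * m) * w x.1 x.2 i)
      = Real.log (d * m) / Real.log 2 := by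
    rw [shannonEntropy_of_eq_zero_or_eq (c := 1 / (d * m))]
    · rw [one_div, Real.logb_inv, neg_neg, Real.logb]
    · intro x
      simp [← Finset.mul_sum, hlabel]
    · simp only [← Finset.mul_sum, hlabel, mul_one, Finset.sum_const, Finset.card_univ,
        Fintype.card_prod, Fintype.card_fin, nsmul_eq_mul, Nat.cast_mul, ← hd]
      field_simp
  have houtcomes : shannonEntropy (fun i => ∑ x : Fin m × κ, 1 / (d * m) * w x.1 x.2 i)
      = (1 / d * ∑ i, Real.negMulLog (T i) + Real.log d) / Real.log 2 := by
    have : ∀ i, ∑ x : Fin m × κ, 1 / (d * m) * w x.1 x.2 i = 1 / d * T i := by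
      intro i
      rw [← Finset.mul_sum, Fintype.sum_prod_type]
      simp only [houtcome, Finset.sum_const, Finset.card_univ, Fintype.card_fin, nsmul_eq_mul]
      field_simp
    simp only [shannonEntropy_eq_sum_negMulLog, this, Real.negMulLog_mul, Finset.sum_add_distrib,
      ← Finset.sum_mul, hT, ← Finset.mul_sum]
    congr 1
    rw [Real.negMulLog, one_div, Real.log_inv]
    field_simp
    ring
  have hjoint : shannonEntropy (fun z : (Fin m × κ) × Fin n => 1 / (d * m) * w z.1.1 z.1.2 z.2)
      = (Real.log (d * m) - 1 / (d * m) * ∑ i, ∑ t, ∑ k, w t k i * Real.log (w t k i))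
        / Real.log 2 := by
    have e : ∀ F : Fin m → κ → Fin n → ℝ,
        ∑ z : (Fin m × κ) × Fin n, F z.1.1 z.1.2 z.2 = ∑ i, ∑ t, ∑ k, F t k i := by
      intro F
      rw [Fintype.sum_prod_type_right]
      simp only [Fintype.sum_prod_type]
    have htotal : ∑ i, ∑ t, ∑ k, w t k i = d * m := by
      simp only [houtcome, Finset.sum_const, Finset.card_univ, Fintype.card_fin, nsmul_eq_mul,
        ← Finset.mul_sum, hT]
      ring
    rw [shannonEntropy_eq_sum_negMulLog]
    simp only [Real.negMulLog_mul, Finset.sum_add_distrib, ← Finset.mul_sum, ← Finset.sum_mul]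
    rw [e w, htotal, e fun t k i => Real.negMulLog (w t k i)]
    congr 1
    simp only [Real.negMulLog_eq_neg, Finset.sum_neg_distrib, one_div, Real.log_inv]
    field_simp
    ring
  -- After division by `d * m`, the terms `T i * log (T i)` cancel the outcome entropy and the terms
  -- with `log d` leave half of it.
  have hbound : ∑ i, ∑ t, ∑ k, w t k i * Real.log (w t k i)
      ≤ ∑ i, m * (T i * Real.log (T i) - T i * Real.log d / 2) :=
    Finset.sum_le_sum fun i _ => sum_le_of_forall_pair hm _ fun t t' htt => by
      have := hunc t t' htt i
      linarith
  have hrhs : ∑ i, m * (T i * Real.log (T i) - T i * Real.log d / 2)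
      = m * (-∑ i, Real.negMulLog (T i) - d * Real.log d / 2) := by
    rw [← Finset.mul_sum, Finset.sum_sub_distrib, ← Finset.sum_div, ← Finset.sum_mul, hT]
    simp only [Real.negMulLog_eq_neg, Finset.sum_neg_distrib, neg_neg]
  rw [hrhs] at hbound
  rw [mutualInformation, hlabels, houtcomes, hjoint, ← add_div, ← sub_div, Real.logb, div_right_comm]
  have hlog2 : 0 < Real.log 2 := Real.log_pos one_lt_two
  gcongr
  have := mul_le_mul_of_nonneg_left hbound (show 0 ≤ 1 / (d * m) by positivity)
  have e : 1 / (d * m) * (m * (-∑ i, Real.negMulLog (T i) - d * Real.log d / 2))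
      = -(1 / d * ∑ i, Real.negMulLog (T i)) - Real.log d / 2 := by
    field_simp
  rw [e] at this
  linarith

/-- If the label, the outcome and the pair of them are uniform on their supports, the last with
weight `c`, then the mutual information is determined by the weights. -/
lemma mutualInformation_of_uniform {κ κ' : Type*} [Fintype κ] [Fintype κ'] {P : κ → κ' → ℝ}
    {a b c : ℝ} (ha : ∀ x, ∑ y, P x y = a) (hb : ∀ y, ∑ x, P x y = b)
    (hc : ∀ x y, P x y = 0 ∨ P x y = c) (hsum : ∑ x, ∑ y, P x y = 1) :
    mutualInformation P = Real.logb 2 c - Real.logb 2 a - Real.logb 2 b := by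
  rw [mutualInformation, shannonEntropy_of_eq_zero_or_eq (fun x => Or.inr (ha x)) hsum,
    shannonEntropy_of_eq_zero_or_eq (fun y => Or.inr (hb y)) (by rw [Finset.sum_comm]; exact hsum),
    shannonEntropy_of_eq_zero_or_eq (fun z => hc z.1 z.2) (by rw [Fintype.sum_prod_type]; exact hsum)]
  ring

lemma trace_mul_ketbra {ι : Type*} [Fintype ι] (M V : Matrix ι ι ℂ) (k : ι) :
    (M * ketbra (V.col k)).trace = (V.conjTranspose * M * V) k k := by
  rw [ketbra, Matrix.mul_vecMulVec, Matrix.trace_vecMulVec, Matrix.mul_assoc, Matrix.mul_apply,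
    dotProduct]
  exact Finset.sum_congr rfl fun j _ => mul_comm _ _

lemma star_col_dotProduct_col {ι : Type*} [Fintype ι] (V W : Matrix ι ι ℂ) (k l : ι) :
    star (V.col k) ⬝ᵥ W.col l = (V.conjTranspose * W) k l := rfl

/-- Unbiasedness gives the overlap constant `c = 1 / √d`, so `2 T log c = - T log d`. The
homogeneous uncertainty relation applies to each POVM element whatever its rank. -/
theorem mutualInformation_le_of_isMUBFamily {ι : Type*} [Fintype ι] [DecidableEq ι] [Nonempty ι]
    {m n : ℕ} (hm : 2 ≤ m) {V : Fin m → Matrix ι ι ℂ} (hV : IsMUBFamily V)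
    {M : Fin n → Matrix ι ι ℂ} (hM : IsPOVM M) :
    mutualInformation (jointDistribution (uniformPrior m ι) (basisState V) M)
      ≤ Real.logb 2 (Fintype.card ι) / 2 := by
  have hVV : ∀ t, (V t).conjTranspose * V t = 1 := fun t => Matrix.mem_unitaryGroup_iff'.mp (hV.1 t)
  have hVV' : ∀ t, V t * (V t).conjTranspose = 1 := fun t => Matrix.mem_unitaryGroup_iff.mp (hV.1 t)
  have hd : (0 : ℝ) < Fintype.card ι := by exact_mod_cast Fintype.card_pos
  have h := mutualInformation_le_of_uncertainty hm
    (fun t k i => (((V t).conjTranspose * M i * V t) k k).re) (fun i => (M i).trace.re) ?_ ?_ ?_ ?_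
  · convert h using 2
    funext x i
    rw [jointDistribution, uniformPrior, basisState, trace_mul_ketbra]
  · intro t k
    rw [← Complex.re_sum, ← Matrix.sum_apply, ← Finset.sum_mul, ← Finset.mul_sum, hM.2,
      Matrix.mul_one, hVV, Matrix.one_apply_eq, Complex.one_re]
  · intro t i
    rw [← Complex.re_sum]
    change ((V t).conjTranspose * M i * V t).trace.re = _
    rw [Matrix.trace_mul_comm, ← Matrix.mul_assoc, hVV', Matrix.one_mul]
  · rw [← Complex.re_sum, ← Matrix.trace_sum, hM.2, Matrix.trace_one, Complex.natCast_re]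
  · intro t t' htt i
    have := sum_mul_log_add_sum_mul_log_le_trace (hV.1 t) (hV.1 t')
      (c := 1 / √(Fintype.card ι)) (by positivity)
      (fun l k => (hV.2 t' t htt.symm l k).le) (hM.1 i)
    rw [one_div, Real.log_inv, Real.log_sqrt hd.le] at this
    linarith

-- Algebra of strings of Pauli matrices

section Strings

variable {p N : ℕ} [Fact p.Prime]

/-- Phases become values of an additive character, so exponents can be computed in `ZMod p` instead
of with representatives. -/
lemma exp_pow_val_eq_stdAddChar (k : ZMod p) (b : ℕ) :
    (Complex.exp (2 * Real.pi * Complex.I / p) ^ k.val) ^ b = ZMod.stdAddChar (k * (b : ZMod p)) := by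
  have h := ZMod.stdAddChar_coe (N := p) ((k.val * b : ℕ) : ℤ)
  rw [Int.cast_natCast, Nat.cast_mul, ZMod.natCast_zmod_val] at h
  rw [h, ← pow_mul, ← Complex.exp_nat_mul]
  congr 1
  push_cast
  ring

lemma pauliX_pow_apply (a : ℕ) (i k : ZMod p) :
    (pauliX p ^ a) i k = if i = k + a then 1 else 0 := by
  induction a generalizing i with
  | zero => simp [Matrix.one_apply]
  | succ a ih =>
    rw [pow_succ', Matrix.mul_apply]
    simp only [ih, mul_ite, mul_one, mul_zero, Finset.sum_ite_eq', Finset.mem_univ, if_true]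
    simp only [pauliX, Matrix.of_apply, Nat.cast_succ, add_assoc]

lemma map_sum_eq_prod_stdAddChar (f : Fin N → ZMod p) :
    (ZMod.stdAddChar (∑ j, f j) : ℂ) = ∏ j, ZMod.stdAddChar (f j) := by
  have := map_prod (AddChar.toMonoidHom (ZMod.stdAddChar (N := p)))
    (fun j => Multiplicative.ofAdd (f j)) Finset.univ
  simpa [← ofAdd_sum] using this

lemma pauliString_apply (g : PauliLabel p N) (i k : Fin N → ZMod p) :
    pauliString g i k = if i = k + g.1 then ZMod.stdAddChar (k ⬝ᵥ g.2) else 0 := by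
  have h : ∀ j, (pauliX p ^ (g.1 j).val * pauliZ p ^ (g.2 j).val) (i j) (k j)
      = if i j = k j + g.1 j then ZMod.stdAddChar (k j * g.2 j) else 0 := by
    intro j
    rw [pauliZ, Matrix.diagonal_pow, Matrix.mul_diagonal, pauliX_pow_apply, Pi.pow_apply,
      exp_pow_val_eq_stdAddChar, ZMod.natCast_zmod_val, ZMod.natCast_zmod_val, ite_mul, one_mul,
      zero_mul]
  rw [pauliString, Matrix.of_apply]
  simp only [h]
  split_ifs with hik
  · rw [dotProduct, map_sum_eq_prod_stdAddChar]
    refine Finset.prod_congr rfl fun j _ => if_pos ?_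
    rw [hik, Pi.add_apply]
  · obtain ⟨j, hj⟩ := Function.ne_iff.mp hik
    exact Finset.prod_eq_zero (Finset.mem_univ j) (if_neg hj)

lemma pauliString_zero : pauliString (0 : PauliLabel p N) = 1 := by
  ext i k
  simp [pauliString_apply, Matrix.one_apply]

/-- Strings of Pauli matrices multiply according to their labels, up to a phase. -/
lemma pauliString_mul (g h : PauliLabel p N) :
    pauliString g * pauliString h
      = (ZMod.stdAddChar (h.1 ⬝ᵥ g.2) : ℂ) • pauliString (g + h) := by
  ext i k
  rw [Matrix.mul_apply, Matrix.smul_apply, smul_eq_mul]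
  simp only [pauliString_apply, mul_ite, mul_zero, Finset.sum_ite_eq', Finset.mem_univ, if_true,
    Prod.fst_add, Prod.snd_add, ite_mul, zero_mul]
  rw [add_assoc, add_comm h.1 g.1]
  refine if_congr Iff.rfl ?_ rfl
  rw [add_dotProduct, dotProduct_add, AddChar.map_add_eq_mul, AddChar.map_add_eq_mul]
  ring

/-- Both products are phases times the string of the sum of the labels. -/
lemma exists_pauliString_mul_eq_smul (g h : PauliLabel p N) :
    ∃ c : ℂ, pauliString g * pauliString h = c • (pauliString h * pauliString g) := by
  refine ⟨ZMod.stdAddChar (h.1 ⬝ᵥ g.2) * ZMod.stdAddChar (-(g.1 ⬝ᵥ h.2)), ?_⟩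
  rw [pauliString_mul, pauliString_mul, add_comm h g, smul_smul, mul_assoc, ← AddChar.map_add_eq_mul,
    neg_add_cancel, AddChar.map_zero_eq_one, mul_one]

lemma conj_stdAddChar_mul (a b : ZMod p) :
    starRingEnd ℂ (ZMod.stdAddChar a) * ZMod.stdAddChar b = ZMod.stdAddChar (b - a) := by
  rw [← AddChar.map_neg_eq_conj, ← AddChar.map_add_eq_mul, neg_add_eq_sub]

lemma sum_stdAddChar_dotProduct (c : Fin N → ZMod p) :
    ∑ k : Fin N → ZMod p, (ZMod.stdAddChar (k ⬝ᵥ c) : ℂ) = if c = 0 then (p : ℂ) ^ N else 0 := by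
  split_ifs with hc
  · simp [hc, ZMod.card]
  · obtain ⟨j, hj⟩ := Function.ne_iff.mp hc
    let ψ : AddChar (Fin N → ZMod p) ℂ :=
      { toFun := fun k => ZMod.stdAddChar (k ⬝ᵥ c)
        map_zero_eq_one' := by simp
        map_add_eq_mul' := fun k l => by rw [add_dotProduct, AddChar.map_add_eq_mul] }
    refine (AddChar.sum_eq_zero_iff_ne_zero (ψ := ψ)).mpr fun hψ => hj ?_
    have h : ZMod.stdAddChar (Pi.single j 1 ⬝ᵥ c) = (1 : ℂ) := DFunLike.congr_fun hψ _
    rw [single_one_dotProduct, ← AddChar.map_zero_eq_one (ZMod.stdAddChar (N := p))] at h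
    exact ZMod.injective_stdAddChar h

/-- Different shifts have disjoint supports; for equal shifts the trace is a character sum. This
Hilbert–Schmidt orthogonality underlies both the expansion along a class and the Bell basis. -/
lemma trace_conjTranspose_pauliString_mul (g h : PauliLabel p N) :
    ((pauliString g).conjTranspose * pauliString h).trace = if g = h then (p : ℂ) ^ N else 0 := by
  have e : ((pauliString g).conjTranspose * pauliString h).trace
      = if g.1 = h.1 then ∑ k, (ZMod.stdAddChar (k ⬝ᵥ (h.2 - g.2)) : ℂ) else 0 := by
    simp only [Matrix.trace, Matrix.diag_apply, Matrix.mul_apply, Matrix.conjTranspose_apply,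
      pauliString_apply, mul_ite, mul_zero, Finset.sum_ite_eq', Finset.mem_univ, if_true,
      add_right_inj]
    by_cases h1 : g.1 = h.1
    · simp [h1, conj_stdAddChar_mul, dotProduct_sub]
    · simp [h1, Ne.symm h1]
  rw [e, sum_stdAddChar_dotProduct, ← ite_and]
  refine if_congr ?_ rfl rfl
  rw [Prod.ext_iff, sub_eq_zero, eq_comm (a := h.2)]

lemma pauliString_mem_unitaryGroup (g : PauliLabel p N) :
    pauliString g ∈ Matrix.unitaryGroup (Fin N → ZMod p) ℂ := by
  rw [Matrix.mem_unitaryGroup_iff']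
  ext i k
  simp only [Matrix.star_eq_conjTranspose, Matrix.mul_apply, Matrix.conjTranspose_apply,
    pauliString_apply, mul_ite, mul_zero, Finset.sum_ite_eq', Finset.mem_univ, if_true,
    add_left_inj, Matrix.one_apply]
  by_cases h : i = k
  · simp [h, conj_stdAddChar_mul]
  · simp [h, Ne.symm h]

end Strings

-- Common eigenbases of commuting classes

section Classes

variable {p N : ℕ} [Fact p.Prime] {V W : Matrix (Fin N → ZMod p) (Fin N → ZMod p) ℂ}
  {C C' : Finset (PauliLabel p N)} {e e' : PauliLabel p N → (Fin N → ZMod p) → ℂ}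

lemma IsPauliClass.zero_notMem (hC : IsPauliClass C) : (0 : PauliLabel p N) ∉ C :=
  fun h => hC.ne_one 0 h pauliString_zero

lemma IsPauliClass.card_insert_zero (hC : IsPauliClass C) : (insert 0 C).card = p ^ N := by
  have : 0 < p ^ N := pow_pos (Fact.out : p.Prime).pos N
  rw [Finset.card_insert_of_notMem hC.zero_notMem, hC.card_eq]
  omega

lemma exists_eigenvalues
    (h : ∀ g ∈ C, ∀ k, ∃ c : ℂ, (pauliString g).mulVec (V.col k) = c • V.col k) :
    ∃ e : PauliLabel p N → (Fin N → ZMod p) → ℂ,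
      ∀ g ∈ insert 0 C, pauliString g * V = V * Matrix.diagonal (e g) := by
  have : ∀ g, ∃ f : (Fin N → ZMod p) → ℂ, g ∈ insert 0 C →
      pauliString g * V = V * Matrix.diagonal f := by
    intro g
    by_cases hg : g ∈ C
    · choose c hc using h g hg
      refine ⟨c, fun _ => ?_⟩
      ext i k
      rw [Matrix.mul_diagonal, mul_comm]
      exact congrFun (hc k) i
    -- The value `1` is the eigenvalue of the identity string, with label `0`; for labels outside
    -- `insert 0 C` it is arbitrary.
    · refine ⟨fun _ => 1, fun hg' => ?_⟩
      obtain rfl := (Finset.mem_insert.mp hg').resolve_right hg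
      rw [pauliString_zero, Matrix.one_mul, Matrix.diagonal_one, Matrix.mul_one]
  choose e he using this
  exact ⟨e, he⟩

lemma conjTranspose_mul_pauliString_mul (hV : V ∈ Matrix.unitaryGroup (Fin N → ZMod p) ℂ)
    (he : ∀ g ∈ insert 0 C, pauliString g * V = V * Matrix.diagonal (e g))
    {g : PauliLabel p N} (hg : g ∈ insert 0 C) :
    V.conjTranspose * pauliString g * V = Matrix.diagonal (e g) := by
  rw [Matrix.mul_assoc, he g hg, ← Matrix.mul_assoc, ← Matrix.star_eq_conjTranspose,
    Matrix.mem_unitaryGroup_iff'.mp hV, Matrix.one_mul]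

lemma trace_conjTranspose_mul_mul (hV : V ∈ Matrix.unitaryGroup (Fin N → ZMod p) ℂ)
    (A : Matrix (Fin N → ZMod p) (Fin N → ZMod p) ℂ) :
    (V.conjTranspose * A * V).trace = A.trace := by
  rw [Matrix.trace_mul_comm, ← Matrix.mul_assoc, ← Matrix.star_eq_conjTranspose,
    Matrix.mem_unitaryGroup_iff.mp hV, Matrix.one_mul]

lemma trace_conjTranspose_pauliString_mul_eq_sum
    (hV : V ∈ Matrix.unitaryGroup (Fin N → ZMod p) ℂ)
    (he : ∀ g ∈ insert 0 C, pauliString g * V = V * Matrix.diagonal (e g))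
    {g : PauliLabel p N} (hg : g ∈ insert 0 C)
    (A : Matrix (Fin N → ZMod p) (Fin N → ZMod p) ℂ) :
    ((pauliString g).conjTranspose * A).trace
      = ∑ k, starRingEnd ℂ (e g k) * (V.conjTranspose * A * V) k k := by
  have h1 : V.conjTranspose * ((pauliString g).conjTranspose * A) * V
      = (Matrix.diagonal (e g)).conjTranspose * (V.conjTranspose * A * V) := by
    have hVV : V * V.conjTranspose = 1 := Matrix.mem_unitaryGroup_iff.mp hV
    rw [← conjTranspose_mul_pauliString_mul hV he hg]
    simp only [Matrix.conjTranspose_mul, Matrix.conjTranspose_conjTranspose, Matrix.mul_assoc]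
    rw [← Matrix.mul_assoc V, hVV, Matrix.one_mul]
  rw [← trace_conjTranspose_mul_mul hV, h1, Matrix.diagonal_conjTranspose, Matrix.trace]
  simp only [Matrix.diag_apply, Matrix.diagonal_mul, Pi.star_apply, RCLike.star_def]

/-- The eigenvalues of a class together with the identity form, up to normalization, a unitary
matrix: the commuting strings span all matrices which are diagonal in the common eigenbasis. -/
lemma sum_conj_eigenvalue_mul_eigenvalue (hV : V ∈ Matrix.unitaryGroup (Fin N → ZMod p) ℂ)
    (hC : IsPauliClass C) (he : ∀ g ∈ insert 0 C, pauliString g * V = V * Matrix.diagonal (e g))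
    (k l : Fin N → ZMod p) :
    ∑ g ∈ insert 0 C, starRingEnd ℂ (e g k) * e g l = if k = l then (p : ℂ) ^ N else 0 := by
  have hs : (p : ℂ) ^ N ≠ 0 := pow_ne_zero _ (Nat.cast_ne_zero.mpr (Fact.out : p.Prime).ne_zero)
  let A : Matrix (insert 0 C : Finset (PauliLabel p N)) (Fin N → ZMod p) ℂ := fun g j => e g j
  let B : Matrix (Fin N → ZMod p) (insert 0 C : Finset (PauliLabel p N)) ℂ :=
    fun j g => ((p : ℂ) ^ N)⁻¹ * starRingEnd ℂ (e g j)
  -- Rows of the eigenvalue table are orthogonal because the strings are. The table is square, as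
  -- the class with the identity has `p ^ N` elements, so its columns are orthogonal too.
  have hAB : A * B = 1 := by
    ext g h
    have := trace_conjTranspose_pauliString_mul_eq_sum hV he h.2 (pauliString g.1)
    rw [trace_conjTranspose_pauliString_mul,
      conjTranspose_mul_pauliString_mul hV he g.2] at this
    simp only [Matrix.diagonal_apply_eq] at this
    rw [Matrix.mul_apply, Matrix.one_apply]
    have e1 : ∀ j, A g j * B j h = ((p : ℂ) ^ N)⁻¹ * (starRingEnd ℂ (e h j) * e g j) :=
      fun j => by simp only [A, B]; ring
    simp only [e1, ← Finset.mul_sum]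
    rw [← this]
    by_cases hgh : g = h
    · simp [hgh, hs]
    · rw [if_neg hgh, if_neg (fun h' => hgh (Subtype.ext h'.symm)), mul_zero]
  have hcard : Fintype.card (insert 0 C : Finset (PauliLabel p N))
      = Fintype.card (Fin N → ZMod p) := by
    rw [Fintype.card_coe, hC.card_insert_zero]
    simp [ZMod.card]
  have hBA := congrFun (congrFun ((Matrix.mul_eq_one_comm_of_equiv (Fintype.equivOfCardEq hcard)).mp hAB) k) l
  rw [Matrix.mul_apply, Matrix.one_apply] at hBA
  simp only [A, B, mul_assoc, ← Finset.mul_sum] at hBA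
  rw [Finset.sum_coe_sort (insert 0 C) (fun g => starRingEnd ℂ (e g k) * e g l)] at hBA
  rw [inv_mul_eq_iff_eq_mul₀ hs] at hBA
  rw [hBA, mul_ite, mul_one, mul_zero]

/-- The diagonal entries of a matrix in the common eigenbasis of a class, in terms of its
components along the strings. -/
lemma card_mul_conjTranspose_mul_mul_apply (hV : V ∈ Matrix.unitaryGroup (Fin N → ZMod p) ℂ)
    (hC : IsPauliClass C) (he : ∀ g ∈ insert 0 C, pauliString g * V = V * Matrix.diagonal (e g))
    (A : Matrix (Fin N → ZMod p) (Fin N → ZMod p) ℂ) (k : Fin N → ZMod p) :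
    (p : ℂ) ^ N * (V.conjTranspose * A * V) k k
      = ∑ g ∈ insert 0 C, e g k * ((pauliString g).conjTranspose * A).trace := by
  calc (p : ℂ) ^ N * (V.conjTranspose * A * V) k k
      = ∑ j, (∑ g ∈ insert 0 C, starRingEnd ℂ (e g j) * e g k)
          * (V.conjTranspose * A * V) j j := by
        simp only [sum_conj_eigenvalue_mul_eigenvalue hV hC he, ite_mul, zero_mul,
          Finset.sum_ite_eq', Finset.mem_univ, if_true]
    _ = ∑ g ∈ insert 0 C, e g k * ∑ j, starRingEnd ℂ (e g j) * (V.conjTranspose * A * V) j j := by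
        simp only [Finset.sum_mul, Finset.mul_sum]
        rw [Finset.sum_comm]
        refine Finset.sum_congr rfl fun g _ => Finset.sum_congr rfl fun j _ => by ring
    _ = _ := Finset.sum_congr rfl fun g hg => by
        rw [trace_conjTranspose_pauliString_mul_eq_sum hV he hg]

/-- The diagonal depends only on the components along the class and the identity, and a string
outside them is orthogonal to all of these. -/
lemma conjTranspose_mul_pauliString_mul_apply_eq_zero
    (hV : V ∈ Matrix.unitaryGroup (Fin N → ZMod p) ℂ)
    (hC : IsPauliClass C) (he : ∀ g ∈ insert 0 C, pauliString g * V = V * Matrix.diagonal (e g))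
    {h : PauliLabel p N} (hh : h ∉ insert 0 C) (k : Fin N → ZMod p) :
    (V.conjTranspose * pauliString h * V) k k = 0 := by
  have hs : (p : ℂ) ^ N ≠ 0 := pow_ne_zero _ (Nat.cast_ne_zero.mpr (Fact.out : p.Prime).ne_zero)
  have := card_mul_conjTranspose_mul_mul_apply hV hC he (pauliString h) k
  rw [Finset.sum_eq_zero] at this
  · exact (mul_eq_zero.mp this).resolve_left hs
  · intro g hg
    rw [trace_conjTranspose_pauliString_mul, if_neg (fun h' : g = h => hh (h' ▸ hg)), mul_zero]

/-- Common eigenbases of disjoint classes are mutually unbiased. -/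
theorem norm_conjTranspose_mul_apply_of_disjoint
    (hV : V ∈ Matrix.unitaryGroup (Fin N → ZMod p) ℂ) (hC : IsPauliClass C)
    (he : ∀ g ∈ insert 0 C, pauliString g * V = V * Matrix.diagonal (e g))
    (hW : W ∈ Matrix.unitaryGroup (Fin N → ZMod p) ℂ) (hC' : IsPauliClass C')
    (he' : ∀ g ∈ insert 0 C', pauliString g * W = W * Matrix.diagonal (e' g))
    (hdisj : Disjoint C C') (k l : Fin N → ZMod p) :
    ‖(V.conjTranspose * W) k l‖ = 1 / √(Fintype.card (Fin N → ZMod p)) := by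
  have hs : (0 : ℝ) < (p : ℝ) ^ N := pow_pos (Nat.cast_pos.mpr (Fact.out : p.Prime).pos) N
  have htrace : ∀ X : Matrix (Fin N → ZMod p) (Fin N → ZMod p) ℂ,
      (X.conjTranspose * ketbra (W.col l)).trace
        = starRingEnd ℂ ((W.conjTranspose * X * W) l l) := by
    intro X
    rw [trace_mul_ketbra, ← RCLike.star_def, ← Matrix.conjTranspose_apply]
    simp only [Matrix.conjTranspose_mul, Matrix.conjTranspose_conjTranspose, Matrix.mul_assoc]
  have hzero : e 0 k = 1 := by
    have h := conjTranspose_mul_pauliString_mul hV he (Finset.mem_insert_self 0 C)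
    rw [pauliString_zero, Matrix.mul_one, ← Matrix.star_eq_conjTranspose,
      Matrix.mem_unitaryGroup_iff'.mp hV] at h
    simpa using (congrFun (congrFun h k) k).symm
  have hWl : (W.conjTranspose * W) l l = 1 := by
    rw [← Matrix.star_eq_conjTranspose, Matrix.mem_unitaryGroup_iff'.mp hW, Matrix.one_apply_eq]
  -- Expand the projector on a vector of `W` along the strings of `C`: those of `C` itself lie
  -- outside `insert 0 C'`, hence contribute nothing, and the identity contributes `1`.
  have key := card_mul_conjTranspose_mul_mul_apply hV hC he (ketbra (W.col l)) k
  rw [Finset.sum_insert hC.zero_notMem, Finset.sum_eq_zero, hzero, htrace, pauliString_zero,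
    Matrix.mul_one, hWl, map_one, one_mul, add_zero] at key
  · have hsq : (V.conjTranspose * ketbra (W.col l) * V) k k
        = ((‖(V.conjTranspose * W) k l‖ ^ 2 : ℝ) : ℂ) := by
      rw [Complex.ofReal_pow, ← Complex.mul_conj', ketbra, Matrix.mul_vecMulVec,
        Matrix.vecMulVec_mul, Matrix.vecMulVec_apply]
      congr 1
      rw [← RCLike.star_def, ← Matrix.conjTranspose_apply, Matrix.conjTranspose_mul,
        Matrix.conjTranspose_conjTranspose]
      rfl
    rw [hsq] at key
    have key' : (p : ℝ) ^ N * ‖(V.conjTranspose * W) k l‖ ^ 2 = 1 := by exact_mod_cast key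
    have hcard : (Fintype.card (Fin N → ZMod p) : ℝ) = (p : ℝ) ^ N := by simp [ZMod.card]
    rw [hcard, ← Real.sqrt_one, ← Real.sqrt_div zero_le_one, eq_comm, Real.sqrt_eq_iff_mul_self_eq
      (by positivity) (norm_nonneg _), ← sq]
    field_simp
    linarith
  · intro g hg
    have hg' : g ∉ insert 0 C' := by
      rw [Finset.mem_insert, not_or]
      exact ⟨fun h => hC.zero_notMem (h ▸ hg), Finset.disjoint_left.mp hdisj hg⟩
    rw [htrace, conjTranspose_mul_pauliString_mul_apply_eq_zero hW hC' he' hg', map_zero, mul_zero]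

/-- A string permutes the common eigenvectors of a class up to phases. -/
theorem norm_conjTranspose_mul_pauliString_mul_apply
    (hV : V ∈ Matrix.unitaryGroup (Fin N → ZMod p) ℂ)
    (hC : IsPauliClass C) (he : ∀ g ∈ insert 0 C, pauliString g * V = V * Matrix.diagonal (e g))
    (h : PauliLabel p N) (j k : Fin N → ZMod p) :
    ‖(V.conjTranspose * pauliString h * V) j k‖ = 0 ∨
      ‖(V.conjTranspose * pauliString h * V) j k‖ = 1 := by
  have hs : (p : ℂ) ^ N ≠ 0 := pow_ne_zero _ (Nat.cast_ne_zero.mpr (Fact.out : p.Prime).ne_zero)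
  have hVV : V * V.conjTranspose = 1 := Matrix.mem_unitaryGroup_iff.mp hV
  set Q := V.conjTranspose * pauliString h * V with hQ
  have hQu : Q ∈ Matrix.unitaryGroup (Fin N → ZMod p) ℂ :=
    mul_mem (mul_mem (Unitary.star_mem hV) (pauliString_mem_unitaryGroup h)) hV
  have hcomm : ∀ g ∈ insert 0 C, ∃ c : ℂ, ∀ i, e g i * Q i k = c * (Q i k * e g k) := by
    intro g hg
    obtain ⟨c, hc⟩ := exists_pauliString_mul_eq_smul g h
    refine ⟨c, fun i => ?_⟩
    have : Matrix.diagonal (e g) * Q = c • (Q * Matrix.diagonal (e g)) := by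
      have hmul : ∀ a b : PauliLabel p N, V.conjTranspose * pauliString a * V
          * (V.conjTranspose * pauliString b * V)
            = V.conjTranspose * (pauliString a * pauliString b) * V := by
        intro a b
        simp only [Matrix.mul_assoc]
        rw [← Matrix.mul_assoc V V.conjTranspose, hVV, Matrix.one_mul]
      rw [← conjTranspose_mul_pauliString_mul hV he hg, hQ, hmul, hmul, hc, Matrix.mul_smul,
        Matrix.smul_mul]
    have := congrFun (congrFun this i) k
    rwa [Matrix.diagonal_mul, Matrix.smul_apply, Matrix.mul_diagonal, smul_eq_mul] at this
  rcases eq_or_ne (Q j k) 0 with hj | hj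
  · exact Or.inl (by rw [hj, norm_zero])
  right
  have hothers : ∀ i, i ≠ j → Q i k = 0 := by
    intro i hij
    by_contra hi
    -- Two nonzero entries in column `k` of `Q` would force equal eigenvalues at `i` and `j` for the
    -- whole class, against the orthogonality of the columns of the eigenvalue table.
    have heq : ∀ g ∈ insert 0 C, e g i = e g j := by
      intro g hg
      obtain ⟨c, hc⟩ := hcomm g hg
      have h1 : e g i = c * e g k := mul_right_cancel₀ hi (by rw [hc i]; ring)
      have h2 : e g j = c * e g k := mul_right_cancel₀ hj (by rw [hc j]; ring)
      rw [h1, h2]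
    have hjj := sum_conj_eigenvalue_mul_eigenvalue hV hC he j j
    have hij' := sum_conj_eigenvalue_mul_eigenvalue hV hC he i j
    rw [if_neg hij, ← Finset.sum_congr rfl (fun g hg => by rw [heq g hg]), hjj, if_pos rfl] at hij'
    exact hs hij'
  have hnorm : ((Q.conjTranspose * Q) k k).re = 1 := by
    rw [← Matrix.star_eq_conjTranspose, Matrix.mem_unitaryGroup_iff'.mp hQu, Matrix.one_apply_eq,
      Complex.one_re]
  rw [re_conjTranspose_mul_self_apply, Finset.sum_eq_single j] at hnorm
  · exact (pow_eq_one_iff_of_nonneg (norm_nonneg _) two_ne_zero).mp hnorm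
  · intro i _ hij
    rw [hothers i hij, norm_zero, zero_pow two_ne_zero]
  · simp

end Classes

-- Basis measurements and product bases

lemma norm_sq_apply_sum_left {ι : Type*} [Fintype ι] [DecidableEq ι] {X : Matrix ι ι ℂ}
    (hX : X ∈ Matrix.unitaryGroup ι ℂ) (k : ι) : ∑ g, ‖X g k‖ ^ 2 = 1 := by
  rw [← re_conjTranspose_mul_self_apply, ← Matrix.star_eq_conjTranspose,
    Matrix.mem_unitaryGroup_iff'.mp hX, Matrix.one_apply_eq, Complex.one_re]

lemma norm_sq_apply_sum_right {ι : Type*} [Fintype ι] [DecidableEq ι] {X : Matrix ι ι ℂ}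
    (hX : X ∈ Matrix.unitaryGroup ι ℂ) (g : ι) : ∑ k, ‖X g k‖ ^ 2 = 1 := by
  have := norm_sq_apply_sum_left (Unitary.star_mem hX) g
  simpa only [Matrix.star_eq_conjTranspose, Matrix.conjTranspose_apply, norm_star] using this

/-- The measurement in an orthonormal basis given by the columns of `R`. -/
noncomputable def basisMeasurement {ι : Type*} [Fintype ι] (R : Matrix ι ι ℂ) (i : Fin (Fintype.card ι)) :
    Matrix ι ι ℂ :=
  ketbra (R.col ((Fintype.equivFin ι).symm i))

lemma isPOVM_basisMeasurement {ι : Type*} [Fintype ι] [DecidableEq ι] {R : Matrix ι ι ℂ}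
    (hR : R ∈ Matrix.unitaryGroup ι ℂ) : IsPOVM (basisMeasurement R) := by
  refine ⟨fun i => Matrix.posSemidef_vecMulVec_self_star _, ?_⟩
  rw [← Matrix.mem_unitaryGroup_iff.mp hR]
  ext x y
  rw [Matrix.sum_apply, Matrix.mul_apply,
    ← Equiv.sum_comp (Fintype.equivFin ι).symm (fun j => R x j * (star R) j y)]
  rfl

lemma isRankOne_basisMeasurement {ι : Type*} [Fintype ι] [DecidableEq ι] {R : Matrix ι ι ℂ}
    (hR : R ∈ Matrix.unitaryGroup ι ℂ) : IsRankOne (basisMeasurement R) := by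
  intro i
  refine ⟨1, R.col ((Fintype.equivFin ι).symm i), zero_le_one, ?_, ?_⟩
  · rw [star_col_dotProduct_col, ← Matrix.star_eq_conjTranspose, Matrix.mem_unitaryGroup_iff'.mp hR,
      Matrix.one_apply_eq]
  · rw [Complex.ofReal_one, one_smul]; rfl

lemma trace_ketbra_mul_ketbra_re {ι : Type*} [Fintype ι] (R V : Matrix ι ι ℂ) (g k : ι) :
    (ketbra (R.col g) * ketbra (V.col k)).trace.re = ‖(R.conjTranspose * V) g k‖ ^ 2 := by
  have : (V.conjTranspose * ketbra (R.col g) * V) k k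
      = ((‖(R.conjTranspose * V) g k‖ ^ 2 : ℝ) : ℂ) := by
    rw [Complex.ofReal_pow, ← Complex.conj_mul', ketbra, Matrix.mul_vecMulVec,
      Matrix.vecMulVec_mul, Matrix.vecMulVec_apply]
    congr 1
    rw [← RCLike.star_def, ← Matrix.conjTranspose_apply, Matrix.conjTranspose_mul,
      Matrix.conjTranspose_conjTranspose]
    rfl
  rw [trace_mul_ketbra, this, Complex.ofReal_re]

/-- The mutual information of a measurement in an orthonormal basis all of whose elements are
uniformly spread over `1 / c` elements of each basis of the ensemble. -/
lemma mutualInformation_basisMeasurement {ι : Type*} [Fintype ι] [DecidableEq ι] [Nonempty ι]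
    {m : ℕ} (hm : 0 < m) {V : Fin m → Matrix ι ι ℂ} (hV : ∀ t, V t ∈ Matrix.unitaryGroup ι ℂ)
    {R : Matrix ι ι ℂ} (hR : R ∈ Matrix.unitaryGroup ι ℂ) {c : ℝ} (hc : 0 < c)
    (hRV : ∀ t g k, ‖(R.conjTranspose * V t) g k‖ ^ 2 = 0 ∨ ‖(R.conjTranspose * V t) g k‖ ^ 2 = c) :
    mutualInformation (jointDistribution (uniformPrior m ι) (basisState V) (basisMeasurement R))
      = Real.logb 2 (Fintype.card ι * c) := by
  set d := (Fintype.card ι : ℝ) with hd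
  have hd0 : 0 < d := Nat.cast_pos.mpr Fintype.card_pos
  have hm0 : (0 : ℝ) < m := Nat.cast_pos.mpr hm
  have hP : ∀ x i, jointDistribution (uniformPrior m ι) (basisState V) (basisMeasurement R) x i
      = 1 / (d * m) * ‖(R.conjTranspose * V x.1) ((Fintype.equivFin ι).symm i) x.2‖ ^ 2 := by
    intro x i
    rw [jointDistribution, uniformPrior, basisMeasurement, basisState, trace_ketbra_mul_ketbra_re]
  have hX : ∀ t, R.conjTranspose * V t ∈ Matrix.unitaryGroup ι ℂ :=
    fun t => mul_mem (Unitary.star_mem hR) (hV t)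
  have hlabel : ∀ x, ∑ i, jointDistribution (uniformPrior m ι) (basisState V)
      (basisMeasurement R) x i = 1 / (d * m) := by
    intro x
    simp only [hP, ← Finset.mul_sum]
    rw [Equiv.sum_comp (Fintype.equivFin ι).symm
      (fun g => ‖(R.conjTranspose * V x.1) g x.2‖ ^ 2), norm_sq_apply_sum_left (hX _), mul_one]
  -- The weights are those of a label, of an outcome and of a pair in the support.
  rw [mutualInformation_of_uniform (a := 1 / (d * m)) (b := 1 / d) (c := 1 / (d * m) * c) hlabel]
  · rw [Real.logb_mul (by positivity) hc.ne', Real.logb_mul hd0.ne' hc.ne', one_div d,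
      Real.logb_inv]
    ring
  · intro i
    simp only [hP, ← Finset.mul_sum]
    rw [Fintype.sum_prod_type]
    simp only [norm_sq_apply_sum_right (hX _), Finset.sum_const, Finset.card_univ, Fintype.card_fin,
      nsmul_eq_mul, mul_one]
    field_simp
  · intro x i
    rw [hP]
    rcases hRV x.1 ((Fintype.equivFin ι).symm i) x.2 with h | h
    · exact Or.inl (by rw [h, mul_zero])
    · exact Or.inr (by rw [h])
  · simp only [hlabel, Finset.sum_const, Finset.card_univ, Fintype.card_prod, Fintype.card_fin,
      nsmul_eq_mul, Nat.cast_mul, ← hd]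
    field_simp

lemma productUnitary_mem_unitaryGroup {ι : Type*} [Fintype ι] [DecidableEq ι] {U : Matrix ι ι ℂ}
    (hU : U ∈ Matrix.unitaryGroup ι ℂ) :
    productUnitary U ∈ Matrix.unitaryGroup (ι × ι) ℂ := by
  refine Matrix.kronecker_mem_unitary hU ?_
  rw [Matrix.mem_unitaryGroup_iff] at hU ⊢
  have := congrArg (fun A : Matrix ι ι ℂ => A.map (starRingEnd ℂ)) hU
  rw [Matrix.map_mul, Matrix.map_one _ (map_zero _) (map_one _)] at this
  exact this

/-- Overlaps of product vectors multiply, up to conjugation of the second factor, and `1 / √s * (1 /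
√s) = 1 / √(s * s)`. -/
lemma isMUBFamily_productUnitary {ι : Type*} [Fintype ι] [DecidableEq ι] {m : ℕ}
    {U : Fin m → Matrix ι ι ℂ} (hU : IsMUBFamily U) :
    IsMUBFamily fun t => productUnitary (U t) := by
  refine ⟨fun t => productUnitary_mem_unitaryGroup (hU.1 t), fun t t' htt k l => ?_⟩
  have h1 : ((productUnitary (U t)).conjTranspose * productUnitary (U t')) k l
      = ((U t).conjTranspose * U t') k.1 l.1
        * starRingEnd ℂ (((U t).conjTranspose * U t') k.2 l.2) := by
    rw [productUnitary, productUnitary, Matrix.conjTranspose_kronecker, ← Matrix.mul_kronecker_mul,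
      Matrix.kronecker_apply]
    congr 1
    simp [Matrix.mul_apply, map_sum]
  have h2 := fun k l => hU.2 t t' htt k l
  simp only [star_col_dotProduct_col] at h2 ⊢
  rw [h1, norm_mul, RCLike.norm_conj, h2, h2, Fintype.card_prod, Nat.cast_mul,
    Real.sqrt_mul (Nat.cast_nonneg _)]
  field_simp

-- The optimal measurement

section Bell

variable {p N : ℕ} [Fact p.Prime]

/-- The orthonormal basis of `ℂ^s ⊗ ℂ^s` obtained by applying the strings of Pauli matrices to one
half of a maximally entangled state. -/
noncomputable def bellBasis (p N : ℕ) [NeZero p] :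
    Matrix (PauliLabel p N) (PauliLabel p N) ℂ :=
  Matrix.of fun x g => (((√((p : ℝ) ^ N))⁻¹ : ℝ) : ℂ) * pauliString g x.1 x.2

/-- The columns are vectorized strings, so their Gram matrix consists of normalized Hilbert–Schmidt
products. -/
lemma bellBasis_mem_unitaryGroup : bellBasis p N ∈ Matrix.unitaryGroup (PauliLabel p N) ℂ := by
  have hs : (0 : ℝ) < (p : ℝ) ^ N := pow_pos (Nat.cast_pos.mpr (Fact.out : p.Prime).pos) N
  rw [Matrix.mem_unitaryGroup_iff', Matrix.star_eq_conjTranspose]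
  ext g h
  have e : ((bellBasis p N).conjTranspose * bellBasis p N) g h
      = (((√((p : ℝ) ^ N))⁻¹ * (√((p : ℝ) ^ N))⁻¹ : ℝ) : ℂ)
        * ((pauliString g).conjTranspose * pauliString h).trace := by
    rw [Matrix.mul_apply, Matrix.trace, Fintype.sum_prod_type_right, Finset.mul_sum]
    refine Finset.sum_congr rfl fun y _ => ?_
    rw [Matrix.diag_apply, Matrix.mul_apply, Finset.mul_sum]
    refine Finset.sum_congr rfl fun x _ => ?_
    simp only [bellBasis, Matrix.conjTranspose_apply, Matrix.of_apply, star_mul', RCLike.star_def,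
      Complex.conj_ofReal, Complex.ofReal_mul]
    ring
  rw [e, trace_conjTranspose_pauliString_mul, Matrix.one_apply, ← mul_inv, Real.mul_self_sqrt hs.le]
  split_ifs
  · rw [Complex.ofReal_inv, Complex.ofReal_pow, Complex.ofReal_natCast]
    exact inv_mul_cancel₀ (by exact_mod_cast hs.ne')
  · rw [mul_zero]

/-- The conjugate in the second factor of `U ⊗ U^*` turns the overlap with a vectorized string into
a matrix entry of that string in the basis `U`. -/
lemma norm_sq_bellBasis_conjTranspose_mul_apply (U : Matrix (Fin N → ZMod p) (Fin N → ZMod p) ℂ)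
    (g : PauliLabel p N) (k : (Fin N → ZMod p) × (Fin N → ZMod p)) :
    ‖((bellBasis p N).conjTranspose * productUnitary U) g k‖ ^ 2
      = ((p : ℝ) ^ N)⁻¹ * ‖(U.conjTranspose * pauliString g * U) k.1 k.2‖ ^ 2 := by
  have hs : (0 : ℝ) < (p : ℝ) ^ N := pow_pos (Nat.cast_pos.mpr (Fact.out : p.Prime).pos) N
  have e : ((bellBasis p N).conjTranspose * productUnitary U) g k
      = (((√((p : ℝ) ^ N))⁻¹ : ℝ) : ℂ)
        * starRingEnd ℂ ((U.conjTranspose * pauliString g * U) k.1 k.2) := by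
    rw [Matrix.mul_apply, Matrix.mul_apply, Fintype.sum_prod_type_right, map_sum, Finset.mul_sum]
    refine Finset.sum_congr rfl fun y _ => ?_
    rw [Matrix.mul_apply, Finset.sum_mul, map_sum, Finset.mul_sum]
    refine Finset.sum_congr rfl fun x _ => ?_
    simp only [bellBasis, productUnitary, Matrix.conjTranspose_apply, Matrix.of_apply,
      Matrix.kroneckerMap_apply, Matrix.map_apply, star_mul', RCLike.star_def, Complex.conj_ofReal,
      map_mul, Complex.conj_conj]
    ring
  rw [e, norm_mul, RCLike.norm_conj, mul_pow, Complex.norm_real, Real.norm_eq_abs, sq_abs, inv_pow,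
    Real.sq_sqrt hs.le]

lemma IsPauliFamily.isMUBFamily {m : ℕ} {U : Fin m → Matrix (Fin N → ZMod p) (Fin N → ZMod p) ℂ}
    (hU : IsPauliFamily U) : IsMUBFamily U := by
  obtain ⟨hunit, C, hC, hdisj, heig⟩ := hU
  refine ⟨hunit, fun t t' htt k l => ?_⟩
  obtain ⟨e, he⟩ := exists_eigenvalues (heig t)
  obtain ⟨e', he'⟩ := exists_eigenvalues (heig t')
  exact norm_conjTranspose_mul_apply_of_disjoint (hunit t) (hC t) he (hunit t') (hC t') he'
    (hdisj t t' htt) k l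

/-- The Bell basis does not depend on `U`, and every squared overlap is `0` or `c = 1 / p ^ N`, so
that `d * c = p ^ N` for any number of bases. -/
lemma IsPauliFamily.mutualInformation_bellBasis {m : ℕ} (hm : 0 < m)
    {U : Fin m → Matrix (Fin N → ZMod p) (Fin N → ZMod p) ℂ} (hU : IsPauliFamily U) :
    mutualInformation (jointDistribution (uniformPrior m (PauliLabel p N))
      (basisState fun t => productUnitary (U t)) (basisMeasurement (bellBasis p N)))
      = Real.logb 2 ((p : ℝ) ^ N) := by
  obtain ⟨hunit, C, hC, -, heig⟩ := hU
  have hs : (0 : ℝ) < (p : ℝ) ^ N := pow_pos (Nat.cast_pos.mpr (Fact.out : p.Prime).pos) N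
  rw [mutualInformation_basisMeasurement hm (fun t => productUnitary_mem_unitaryGroup (hunit t))
    bellBasis_mem_unitaryGroup (inv_pos.mpr hs)]
  · congr 1
    simp only [Fintype.card_prod, Fintype.card_pi, ZMod.card, Finset.prod_const, Finset.card_univ,
      Fintype.card_fin, Nat.cast_mul, Nat.cast_pow]
    exact mul_inv_cancel_right₀ hs.ne' _
  · intro t g k
    obtain ⟨e, he⟩ := exists_eigenvalues (heig t)
    rw [norm_sq_bellBasis_conjTranspose_mul_apply]
    rcases norm_conjTranspose_mul_pauliString_mul_apply (hunit t) (hC t) he g k.1 k.2 with h | h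
    · exact Or.inl (by rw [h, zero_pow two_ne_zero, mul_zero])
    · exact Or.inr (by rw [h, one_pow, mul_one])

end Bell

end PauliLocking

theorem corollary5 (p : ℕ) [Fact p.Prime] (N : ℕ) (hN : 1 ≤ N) (m : ℕ) (hm : 2 ≤ m)
    (U : Fin m → Matrix (Fin N → ZMod p) (Fin N → ZMod p) ℂ)
    (hU : PauliLocking.IsPauliFamily U)
    (B : Fin m → Matrix ((Fin N → ZMod p) × (Fin N → ZMod p))
      ((Fin N → ZMod p) × (Fin N → ZMod p)) ℂ)
    (hB : ∀ t, B t = PauliLocking.productUnitary (U t))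
    (s d : ℕ) (hs : s = p ^ N) (hd : d = s ^ 2) :
    PauliLocking.IsMUBFamily U ∧ PauliLocking.IsMUBFamily B ∧
    PauliLocking.IsAccessibleInformation
      (PauliLocking.uniformPrior m ((Fin N → ZMod p) × (Fin N → ZMod p)))
      (PauliLocking.basisState B) (Real.logb 2 d / 2) ∧
    PauliLocking.IsRankOneAccessibleInformation
      (PauliLocking.uniformPrior m ((Fin N → ZMod p) × (Fin N → ZMod p)))
      (PauliLocking.basisState B) (Real.logb 2 d / 2) := by

  obtain rfl : B = fun t => PauliLocking.productUnitary (U t) := funext hB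
  have hMUB := hU.isMUBFamily
  have hMUB' := PauliLocking.isMUBFamily_productUnitary hMUB
  have hcard : Fintype.card ((Fin N → ZMod p) × (Fin N → ZMod p)) = d := by
    rw [hd, hs, sq]
    simp [ZMod.card]
  have hd2 : Real.logb 2 ((p : ℝ) ^ N) = Real.logb 2 d / 2 := by
    have := Real.logb_pow 2 ((p : ℝ) ^ N) 2
    rw [hd, hs, Nat.cast_pow, Nat.cast_pow, this, Nat.cast_ofNat, mul_div_cancel_left₀ _ two_ne_zero]
  have hattained := hU.mutualInformation_bellBasis (by omega)
  rw [hd2] at hattained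
  have hPOVM := PauliLocking.isPOVM_basisMeasurement
    (PauliLocking.bellBasis_mem_unitaryGroup (p := p) (N := N))
  have hle : ∀ {n : ℕ} (M : Fin n → Matrix ((Fin N → ZMod p) × (Fin N → ZMod p))
      ((Fin N → ZMod p) × (Fin N → ZMod p)) ℂ), PauliLocking.IsPOVM M →
      PauliLocking.mutualInformation (PauliLocking.jointDistribution
        (PauliLocking.uniformPrior m _)
        (PauliLocking.basisState fun t => PauliLocking.productUnitary (U t)) M)
        ≤ Real.logb 2 d / 2 := by
    intro n M hM
    rw [← hcard]
    exact PauliLocking.mutualInformation_le_of_isMUBFamily hm hMUB' hM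
  -- The Bell measurement has rank one, so the same witness and the same upper bound settle both
  -- maxima.
  refine ⟨hMUB, hMUB', ⟨⟨_, _, hPOVM, hattained.symm⟩, ?_⟩,
    ⟨⟨_, _, hPOVM, PauliLocking.isRankOne_basisMeasurement
      PauliLocking.bellBasis_mem_unitaryGroup, hattained.symm⟩, ?_⟩⟩
  · rintro _ ⟨n, M, hM, rfl⟩
    exact hle M hM
  · rintro _ ⟨n, M, hM, -, rfl⟩
    exact hle M hM
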